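/- Consider linear bilevel problems with rational data $G,g,c,d,f,C,D,b$. Let $X=\{x : Gx\ge g\}$, for each $x$ let $S(x)$ be the set of optimal solutions of the follower's problem $\min_y\{f^\top y : Cx+Dy\ge b\}$, and consider the optimistic bilevel problem without coupling constraints $$\min_{x\in X}\ F_{\mathrm o}(x):=c^\top x+\min_y\{d^\top y : y\in S(x)\}.$$ Assume that $X\neq\emptyset$, that $\{y : Cx+Dy\ge b\}$ is non-empty and compact for every $x\in X$, and that $F_{\mathrm o}$ is bounded from below on $X$. For $\kappa>0$ consider the pessimistic bilevel problem without coupling constraints $$\min_{(x,\bar y)\in\tilde X}\ c^\top x+d^\top\bar y+\max_{y,\varepsilon}\{\kappa\varepsilon : (y,\varepsilon)\in\tilde S(x,\bar y)\},$$ where $\tilde X=\{(x,\bar y) : x\in X,\ Cx+D\bar y\ge b\}$ and $\tilde S(x,\bar y)$ is the set of optimal solutions of $$\min_{y,\varepsilon}\ f^\top y\quad\text{s.t.}\quad Cx+Dy\ge b,\quad f^\top\bar y-f^\top y=\varepsilon,\quad \varepsilon\ge 0 .$$ Then there is a polynomial $p$ such that for every such problem (of any dimensions) there is a rational $\kappa>0$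 whose binary encoding length is at most $p(L)$, where $L$ is the binary encoding length of the data $(G,g,c,d,f,C,D,b)$, for which the optimistic and the pessimistic problem have the same globally optimal solutions in the following sense: the set of globally optimal $x$ of the optimistic problem is the projection onto the $x$-space of the set of globally optimal $(x,\bar y)$ of the pessimistic problem. More precisely, $(x,\bar y)$ is globally optimal for the pessimistic problem if and only if $x$ is globally optimal for the optimistic problem and $\bar y\in\operatorname{argmin}_y\{d^\top y : y\in S(x)\}$. -/

import Mathlib

noncomputable section

/-- Encoding length of a rational `p/q` in lowest terms: one sign bit, plus the binary lengths
`⌈log₂ (|p| + 1)⌉` and `⌈log₂ (q + 1)⌉` of numerator and denominator. -/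
def ratBitSize (q : ℚ) : ℕ :=
  1 + Nat.size q.num.natAbs + Nat.size q.den

/-- Encoding length of a rational vector. -/
def vecBitSize {n : ℕ} (v : Fin n → ℚ) : ℕ :=
  n + ∑ i, ratBitSize (v i)

/-- Encoding length of a rational matrix. -/
def matBitSize {m n : ℕ} (A : Matrix (Fin m) (Fin n) ℚ) : ℕ :=
  m * n + ∑ i, ∑ j, ratBitSize (A i j)

/-- The set of global minimizers of `g` over `s`. -/
def globalMinimizers {α β : Type*} [Preorder β] (s : Set α) (g : α → β) : Set α :=
  {z | z ∈ s ∧ ∀ z' ∈ s, g z ≤ g z'}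

/-- The rational data of a linear bilevel problem without coupling constraints: `nx` leader
variables, `ny` follower variables, the leader's polyhedron `X = {x | G x ≥ g}` given by `k`
inequalities, the leader's objective `cᵀ x + dᵀ y`, and the follower's problem
`min fᵀ y` subject to the `m` inequalities `C x + D y ≥ b`. -/
structure LinearBilevel (nx ny k m : ℕ) where
  G : Matrix (Fin k) (Fin nx) ℚ
  g : Fin k → ℚ
  c : Fin nx → ℚ
  d : Fin ny → ℚ
  f : Fin ny → ℚ
  C : Matrix (Fin m) (Fin nx) ℚ
  D : Matrix (Fin m) (Fin ny) ℚ
  b : Fin m → ℚ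

namespace LinearBilevel

variable {nx ny k m : ℕ} (P : LinearBilevel nx ny k m)

/-- Encoding length of the problem's data. -/
def bitSize : ℕ :=
  matBitSize P.G + vecBitSize P.g + vecBitSize P.c + vecBitSize P.d + vecBitSize P.f
    + matBitSize P.C + matBitSize P.D + vecBitSize P.b

/-- The leader's polyhedron `X`. -/
def X : Set (Fin nx → ℝ) :=
  {x | ∀ i, (P.g i : ℝ) ≤ ∑ j, (P.G i j : ℝ) * x j}

/-- `cᵀ x`. -/
def cVal (x : Fin nx → ℝ) : ℝ := ∑ j, (P.c j : ℝ) * x j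

/-- `dᵀ y`. -/
def dVal (y : Fin ny → ℝ) : ℝ := ∑ j, (P.d j : ℝ) * y j

/-- `fᵀ y`. -/
def fVal (y : Fin ny → ℝ) : ℝ := ∑ j, (P.f j : ℝ) * y j

/-- The follower's feasible set `{y | C x + D y ≥ b}`. -/
def lowerFeasible (x : Fin nx → ℝ) : Set (Fin ny → ℝ) :=
  {y | ∀ i, (P.b i : ℝ) ≤ ∑ j, (P.C i j : ℝ) * x j + ∑ j, (P.D i j : ℝ) * y j}

/-- `S(x)`, the set of optimal solutions of the follower's problem. -/
def S (x : Fin nx → ℝ) : Set (Fin ny → ℝ) :=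
  globalMinimizers (P.lowerFeasible x) P.fVal

/-- The optimistic objective `F_o(x) = cᵀ x + min {dᵀ y | y ∈ S(x)}`, with values in the
extended reals (so a minimum over the empty set is `+∞`). -/
def optimisticObjective (x : Fin nx → ℝ) : EReal :=
  (P.cVal x : EReal) + ⨅ y ∈ P.S x, (P.dVal y : EReal)

/-- The globally optimal solutions of the optimistic problem. -/
def optimisticSolutions : Set (Fin nx → ℝ) :=
  globalMinimizers P.X P.optimisticObjective

/-- `X̃`, the set of `(x, ȳ)` with `x ∈ X` and `ȳ` lower-level feasible for `x`. -/
def XTilde : Set ((Fin nx → ℝ) × (Fin ny → ℝ)) :=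
  {p | p.1 ∈ P.X ∧ p.2 ∈ P.lowerFeasible p.1}

/-- The feasible `(y, ε)` of the modified follower's problem:
`C x + D y ≥ b`, `fᵀ ȳ - fᵀ y = ε`, `ε ≥ 0`. -/
def epsLowerFeasible (x : Fin nx → ℝ) (ybar : Fin ny → ℝ) : Set ((Fin ny → ℝ) × ℝ) :=
  {q | q.1 ∈ P.lowerFeasible x ∧ P.fVal ybar - P.fVal q.1 = q.2 ∧ 0 ≤ q.2}

/-- `S̃(x, ȳ)`, the set of optimal `(y, ε)` of the modified follower's problem, whose objective
is `fᵀ y`. -/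
def STilde (x : Fin nx → ℝ) (ybar : Fin ny → ℝ) : Set ((Fin ny → ℝ) × ℝ) :=
  globalMinimizers (P.epsLowerFeasible x ybar) (fun q => P.fVal q.1)

/-- The pessimistic objective `cᵀ x + dᵀ ȳ + max {κ ε | (y, ε) ∈ S̃(x, ȳ)}`. -/
def pessimisticObjective (κ : ℝ) (p : (Fin nx → ℝ) × (Fin ny → ℝ)) : EReal :=
  ((P.cVal p.1 + P.dVal p.2 : ℝ) : EReal)
    + ⨆ q ∈ P.STilde p.1 p.2, ((κ * q.2 : ℝ) : EReal)

/-- The globally optimal solutions `(x, ȳ)` of the pessimistic problem. -/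
def pessimisticSolutions (κ : ℝ) : Set ((Fin nx → ℝ) × (Fin ny → ℝ)) :=
  globalMinimizers P.XTilde (P.pessimisticObjective κ)

/-- The standing assumptions (rationality of the data is built into `LinearBilevel`). -/
structure StandingAssumptions : Prop where
  lower_nonempty : ∀ x ∈ P.X, (P.lowerFeasible x).Nonempty
  lower_compact : ∀ x ∈ P.X, IsCompact (P.lowerFeasible x)
  X_nonempty : P.X.Nonempty
  bounded_below : ∃ M : ℝ, ∀ x ∈ P.X, (M : EReal) ≤ P.optimisticObjective x

end LinearBilevel

end

/-!
For fixed `x`, minimizing `dᵀ y` over `S(x)` is the linear program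
`min {dᵀ y | -fᵀ y ≥ -φ(x), D y ≥ b - C x}`, where `φ(x)` is the follower's optimal value. The
multiplier `μ` of the constraint `-fᵀ y ≥ -φ(x)` bounds how much `dᵀ y` can decrease per unit of
the follower's suboptimality `fᵀ y - φ(x)`. The pessimistic objective is `cᵀ x + dᵀ ȳ` plus `κ`
times this suboptimality, so for every `κ > μ` it is an exact penalty for the constraint
`ȳ ∈ S(x)`.

Since the multipliers can be chosen as the coefficients of `d` with respect to linearly independent
rows of a matrix that does not depend on `x`, Cramer's rule bounds `μ` uniformly in `x`: for data
of encoding length `L`, clearing denominators leaves integers of size at most `2 ^ L`, and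
`μ ≤ 2 ^ (4 * L ^ 2)`.
-/

section LinearPrograms

variable {𝕜 ι E : Type*} [Field 𝕜] [LinearOrder 𝕜] [AddCommGroup E] [Module 𝕜 E]

theorem exists_nonneg_combination_insert [DecidableEq ι] {v : ι → E} {s : Finset ι} {k : ι}
    (hk : k ∉ s) {r : 𝕜} (hr : 0 ≤ r) {t : ι → 𝕜} (ht : ∀ i ∈ s, 0 ≤ t i) :
    ∃ t' : ι → 𝕜, (∀ i ∈ insert k s, 0 ≤ t' i) ∧
      ∑ i ∈ insert k s, t' i • v i = r • v k + ∑ i ∈ s, t i • v i := by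
  have hne : ∀ i ∈ s, i ≠ k := fun i hi => ne_of_mem_of_not_mem hi hk
  refine ⟨Function.update t k r, ?_, ?_⟩
  · rw [Finset.forall_mem_insert, Function.update_self]
    exact ⟨hr, fun i hi => by simpa [hne i hi] using ht i hi⟩
  · rw [Finset.sum_insert hk, Function.update_self]
    exact congrArg _ (Finset.sum_congr rfl fun i hi => by simp [hne i hi])

variable [IsStrictOrderedRing 𝕜]

-- Induction on the constraints. If `a k` cannot be dropped, some `x` satisfies the other
-- constraints although `c x < 0`, so `a k x < 0`; project along `x` onto the kernel of `a k`.
theorem exists_nonneg_combination_of_forall_nonneg (a : ι → Module.Dual 𝕜 E) (s : Finset ι)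
    (c : Module.Dual 𝕜 E) (h : ∀ z, (∀ i ∈ s, 0 ≤ a i z) → 0 ≤ c z) :
    ∃ t : ι → 𝕜, (∀ i ∈ s, 0 ≤ t i) ∧ ∑ i ∈ s, t i • a i = c := by
  classical
  induction s using Finset.induction_on generalizing a c with
  | empty =>
    refine ⟨0, by simp, LinearMap.ext fun z => le_antisymm (by simpa using h z) ?_⟩
    simpa using h (-z)
  | insert k s hk ih =>
    by_cases hs : ∀ z, (∀ i ∈ s, 0 ≤ a i z) → 0 ≤ c z
    · obtain ⟨t, ht, hsum⟩ := ih a c hs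
      simpa only [zero_smul, zero_add, hsum] using
        exists_nonneg_combination_insert (v := a) hk le_rfl ht
    push Not at hs
    obtain ⟨x, hx, hcx⟩ := hs
    have hkx : a k x < 0 := by
      by_contra! hkx
      exact hcx.not_ge (h x (Finset.forall_mem_insert _ _ _ |>.2 ⟨hkx, hx⟩))
    let π : E →ₗ[𝕜] E := LinearMap.id - (a k).smulRight ((a k x)⁻¹ • x)
    have hπ (b : Module.Dual 𝕜 E) (z : E) : b (π z) = b z - b x / a k x * a k z := by
      simp only [π, LinearMap.sub_apply, LinearMap.id_apply, LinearMap.smulRight_apply, map_sub,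
        map_smul, smul_eq_mul]
      ring
    obtain ⟨t, ht, hsum⟩ := ih (fun i => a i ∘ₗ π) (c ∘ₗ π) fun z hz =>
      h (π z) (Finset.forall_mem_insert _ _ _ |>.2 ⟨by simp [hπ, hkx.ne], hz⟩)
    let ψ : Module.Dual 𝕜 E := c - ∑ i ∈ s, t i • a i
    have hψπ (z : E) : ψ (π z) = 0 := by
      simpa [ψ, sub_eq_zero] using (LinearMap.congr_fun hsum z).symm
    have hψx : ψ x ≤ 0 := by
      have : 0 ≤ ∑ i ∈ s, t i * a i x :=
        Finset.sum_nonneg fun i hi => mul_nonneg (ht i hi) (hx i hi)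
      simp only [ψ, LinearMap.sub_apply, LinearMap.sum_apply, LinearMap.smul_apply, smul_eq_mul]
      linarith
    have hψ : ψ = (ψ x / a k x) • a k :=
      LinearMap.ext fun z => sub_eq_zero.1 ((hπ ψ z).symm.trans (hψπ z))
    simpa only [← hψ, ψ, sub_add_cancel] using
      exists_nonneg_combination_insert (v := a) hk (div_nonneg_of_nonpos hψx hkx.le) ht

theorem exists_nonneg_combination_erase_of_not_linearIndepOn [DecidableEq ι] {v : ι → E}
    {s : Finset ι} (hs : ¬LinearIndepOn 𝕜 v (s : Set ι)) {t : ι → 𝕜} (ht : ∀ i ∈ s, 0 ≤ t i) :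
    ∃ k ∈ s, ∃ t' : ι → 𝕜, (∀ i ∈ s.erase k, 0 ≤ t' i) ∧
      ∑ i ∈ s.erase k, t' i • v i = ∑ i ∈ s, t i • v i := by
  obtain ⟨g, hg, j, hjs, hj⟩ : ∃ g : ι → 𝕜, ∑ i ∈ s, g i • v i = 0 ∧ ∃ j ∈ s, 0 < g j := by
    obtain ⟨g, hg, j, hjs, hj⟩ := not_linearIndepOn_finset_iff.1 hs
    rcases hj.lt_or_gt with hneg | hpos
    · exact ⟨-g, by simp [hg], j, hjs, neg_pos.2 hneg⟩
    · exact ⟨g, hg, j, hjs, hpos⟩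
  obtain ⟨k, hk, hmin⟩ := Finset.exists_min_image {i ∈ s | 0 < g i} (fun i => t i / g i)
    ⟨j, Finset.mem_filter.2 ⟨hjs, hj⟩⟩
  obtain ⟨hks, hgk⟩ := Finset.mem_filter.1 hk
  have hratio : 0 ≤ t k / g k := div_nonneg (ht k hks) hgk.le
  refine ⟨k, hks, fun i => t i - t k / g k * g i, fun i hi => sub_nonneg.2 ?_, ?_⟩
  · have his := Finset.mem_of_mem_erase hi
    rcases lt_or_ge 0 (g i) with hgi | hgi
    · exact (le_div_iff₀ hgi).1 (hmin i (Finset.mem_filter.2 ⟨his, hgi⟩))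
    · exact (mul_nonpos_of_nonneg_of_nonpos hratio hgi).trans (ht i his)
  · rw [Finset.sum_erase _ (by simp only [div_mul_cancel₀ _ hgk.ne', sub_self, zero_smul])]
    simp only [sub_smul, mul_smul, Finset.sum_sub_distrib, ← Finset.smul_sum, hg, smul_zero,
      sub_zero]

theorem exists_linearIndepOn_nonneg_combination (v : ι → E) (s : Finset ι) (t : ι → 𝕜)
    (ht : ∀ i ∈ s, 0 ≤ t i) :
    ∃ s' ⊆ s, ∃ t' : ι → 𝕜, (∀ i ∈ s', 0 ≤ t' i) ∧ LinearIndepOn 𝕜 v (s' : Set ι) ∧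
      ∑ i ∈ s', t' i • v i = ∑ i ∈ s, t i • v i := by
  classical
  induction s using Finset.strongInduction generalizing t with
  | H s ih =>
    by_cases hs : LinearIndepOn 𝕜 v (s : Set ι)
    · exact ⟨s, subset_rfl, t, ht, hs, rfl⟩
    obtain ⟨k, hk, u, hu, hsum⟩ := exists_nonneg_combination_erase_of_not_linearIndepOn hs ht
    obtain ⟨s', hs', t', ht', hind, hsum'⟩ := ih _ (Finset.erase_ssubset hk) u hu
    exact ⟨s', hs'.trans (Finset.erase_subset _ _), t', ht', hind, hsum'.trans hsum⟩

theorem exists_pos_forall_le_apply_add_smul [Finite ι] {a : ι → Module.Dual 𝕜 E} {β : ι → 𝕜}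
    {y z : E} (hy : ∀ i, β i ≤ a i y) (hz : ∀ i, a i y = β i → 0 ≤ a i z) :
    ∃ δ : 𝕜, 0 < δ ∧ ∀ i, β i ≤ a i (y + δ • z) := by
  have hlarge : ∀ᶠ r : 𝕜 in Filter.atTop, ∀ i, -a i z ≤ r * (a i y - β i) := by
    refine Filter.eventually_all.2 fun i => ?_
    rcases (hy i).eq_or_lt with hact | hslack
    · exact .of_forall fun r => by simpa [hact] using hz i hact.symm
    · exact (Filter.tendsto_id.atTop_mul_const (sub_pos.2 hslack)).eventually_ge_atTop _
  obtain ⟨r, hr, hr0⟩ := (hlarge.and (Filter.eventually_gt_atTop 0)).exists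
  refine ⟨r⁻¹, inv_pos.2 hr0, fun i => ?_⟩
  have := mul_le_mul_of_nonneg_left (hr i) (inv_pos.2 hr0).le
  rw [inv_mul_cancel_left₀ hr0.ne'] at this
  rw [map_add, map_smul, smul_eq_mul]
  linarith

theorem exists_linearIndepOn_multipliers [Finite ι] {a : ι → Module.Dual 𝕜 E} {β : ι → 𝕜}
    {c : Module.Dual 𝕜 E} {y : E} (hy : ∀ i, β i ≤ a i y)
    (hmin : ∀ z, (∀ i, β i ≤ a i z) → c y ≤ c z) :
    ∃ (s : Finset ι) (t : ι → 𝕜), (∀ i ∈ s, a i y = β i) ∧ (∀ i ∈ s, 0 ≤ t i) ∧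
      LinearIndepOn 𝕜 a (s : Set ι) ∧ ∑ i ∈ s, t i • a i = c := by
  classical
  have := Fintype.ofFinite ι
  let active : Finset ι := {i | a i y = β i}
  have hdir (z : E) (hz : ∀ i ∈ active, 0 ≤ a i z) : 0 ≤ c z := by
    obtain ⟨δ, hδ, hfeas⟩ :=
      exists_pos_forall_le_apply_add_smul hy fun i hi => hz i (by simpa [active] using hi)
    have := hmin _ hfeas
    rw [map_add, map_smul, smul_eq_mul, le_add_iff_nonneg_right] at this
    exact nonneg_of_mul_nonneg_right this hδ
  obtain ⟨t, ht, hsum⟩ := exists_nonneg_combination_of_forall_nonneg a active c hdir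
  obtain ⟨s, hs, t', ht', hind, hsum'⟩ := exists_linearIndepOn_nonneg_combination a active t ht
  exact ⟨s, t', fun i hi => (Finset.mem_filter.1 (hs hi)).2, ht', hind, hsum'.trans hsum⟩

end LinearPrograms

section IntegralSystems

open Matrix

theorem det_mul_apply_eq_det_updateRow {n R : Type*} [Fintype n] [DecidableEq n] [CommRing R]
    (A : Matrix n n R) (t : n → R) (i : n) :
    A.det * t i = (A.updateRow i (t ᵥ* A)).det := by
  rw [← cramer_transpose_apply, cramer_eq_adjugate_mulVec, ← mulVec_transpose, mulVec_mulVec,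
    adjugate_mul, smul_mulVec, one_mulVec, det_transpose, Pi.smul_apply, smul_eq_mul]

variable {𝕜 ι n : Type*} [Field 𝕜] [LinearOrder 𝕜] [IsStrictOrderedRing 𝕜]
  [Fintype ι] [Fintype n]

theorem abs_le_of_vecMul_intCast_eq [DecidableEq n] {M : Matrix n n ℤ} (hdet : M.det ≠ 0)
    {u : n → ℤ} {b : ℕ} (hM : ∀ i j, |M i j| ≤ b) (hu : ∀ j, |u j| ≤ b) {t : n → 𝕜}
    (ht : t ᵥ* M.map (↑) = fun j => (u j : 𝕜)) (i : n) :
    |t i| ≤ ((Fintype.card n).factorial * b ^ Fintype.card n : ℕ) := by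
  have hcramer : (M.det : 𝕜) * t i = (M.updateRow i u).det := by
    rw [Int.cast_det, Int.cast_det, det_mul_apply_eq_det_updateRow, ht, map_updateRow]
    rfl
  have hone : (1 : 𝕜) ≤ |(M.det : 𝕜)| := by exact_mod_cast Int.one_le_abs hdet
  have hbound : |(M.updateRow i u).det| ≤
      ((Fintype.card n).factorial * b ^ Fintype.card n : ℕ) := by
    have := det_le (A := M.updateRow i u) (abv := AbsoluteValue.abs) (x := b) fun k l => by
      rw [updateRow_apply]
      split_ifs
      exacts [hu l, hM k l]
    simpa using this
  calc |t i| ≤ |(M.det : 𝕜)| * |t i| := le_mul_of_one_le_left (abs_nonneg _) hone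
    _ = |(((M.updateRow i u).det : ℤ) : 𝕜)| := by rw [← abs_mul, hcramer]
    _ ≤ _ := by exact_mod_cast hbound

theorem det_self_mul_transpose_ne_zero [DecidableEq ι] {A : Matrix ι n 𝕜}
    (hA : LinearIndependent 𝕜 A.row) : (A * Aᵀ).det ≠ 0 := by
  intro hdet
  obtain ⟨v, hv, hvA⟩ := exists_mulVec_eq_zero_iff.2 hdet
  have hsq : (v ᵥ* A) ⬝ᵥ (v ᵥ* A) = 0 := by
    rw [← dotProduct_mulVec, ← mulVec_transpose, mulVec_mulVec, hvA, dotProduct_zero]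
  refine hv (vecMul_injective_iff.2 hA ?_)
  simpa using dotProduct_self_eq_zero.1 hsq

theorem abs_dotProduct_le {R : Type*} [CommRing R] [LinearOrder R] [IsStrictOrderedRing R]
    {p q : n → R} {B : R} (hp : ∀ j, |p j| ≤ B) (hq : ∀ j, |q j| ≤ B) :
    |p ⬝ᵥ q| ≤ Fintype.card n * B ^ 2 :=
  calc |p ⬝ᵥ q| ≤ ∑ j, |p j * q j| := Finset.abs_sum_le_sum_abs _ _
    _ ≤ ∑ _j : n, B ^ 2 := Finset.sum_le_sum fun j _ => by
        rw [abs_mul, sq]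
        exact mul_le_mul (hp j) (hq j) (abs_nonneg _) ((abs_nonneg _).trans (hp j))
    _ = Fintype.card n * B ^ 2 := by simp

-- Multiplying by `Aᵀ` turns the system into one with the nonsingular integral Gram matrix `A * Aᵀ`.
theorem abs_le_of_vecMul_intCast_eq_of_linearIndependent {A : Matrix ι n ℤ}
    (hind : LinearIndependent 𝕜 (A.map ((↑) : ℤ → 𝕜)).row) {w : n → ℤ} {B : ℕ}
    (hA : ∀ i j, |A i j| ≤ B) (hw : ∀ j, |w j| ≤ B) {t : ι → 𝕜}
    (ht : t ᵥ* A.map (↑) = fun j => (w j : 𝕜)) (i : ι) :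
    |t i| ≤ ((Fintype.card ι).factorial * (Fintype.card n * B ^ 2) ^ Fintype.card ι : ℕ) := by
  classical
  set AK : Matrix ι n 𝕜 := A.map (↑)
  have hgram : (A * Aᵀ).map (↑) = AK * AKᵀ := by
    ext i j
    simp [AK, mul_apply]
  have hdet : (A * Aᵀ).det ≠ 0 := by
    have := det_self_mul_transpose_ne_zero hind
    rw [← hgram, ← Int.cast_det] at this
    exact_mod_cast this
  refine abs_le_of_vecMul_intCast_eq hdet (u := w ᵥ* Aᵀ) (fun i j => ?_) (fun j => ?_) ?_ i
  · exact_mod_cast abs_dotProduct_le (hA i) (hA j)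
  · exact_mod_cast abs_dotProduct_le hw (hA j)
  · rw [hgram, ← vecMul_vecMul, ht]
    ext j
    simp [AK, vecMul, dotProduct]

end IntegralSystems

section RationalSystems

theorem natAbs_num_le_two_pow_ratBitSize (q : ℚ) : q.num.natAbs ≤ 2 ^ ratBitSize q :=
  q.num.natAbs.lt_size_self.le.trans (Nat.pow_le_pow_right two_pos (by unfold ratBitSize; omega))

theorem den_le_two_pow_ratBitSize (q : ℚ) : q.den ≤ 2 ^ ratBitSize q :=
  q.den.lt_size_self.le.trans (Nat.pow_le_pow_right two_pos (by unfold ratBitSize; omega))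

theorem ratBitSize_neg (q : ℚ) : ratBitSize (-q) = ratBitSize q := by
  simp [ratBitSize]

theorem ratBitSize_two_pow (k : ℕ) : ratBitSize (2 ^ k) = k + 3 := by
  have : (2 : ℚ) ^ k = (2 ^ k : ℕ) := by push_cast; rfl
  rw [this, ratBitSize, Rat.num_natCast, Rat.den_natCast, Int.natAbs_natCast, Nat.size_pow,
    Nat.size_one]
  omega

theorem card_le_sum_ratBitSize {ι : Type*} [Fintype ι] (q : ι → ℚ) :
    Fintype.card ι ≤ ∑ i, ratBitSize (q i) := by
  simpa using Finset.card_nsmul_le_sum Finset.univ (fun i => ratBitSize (q i)) 1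
    fun i _ => by unfold ratBitSize; omega

theorem exists_common_denominator {ι : Type*} [Fintype ι] (q : ι → ℚ) :
    ∃ (N : ℕ) (z : ι → ℤ), 0 < N ∧ (∀ i, (N : ℚ) * q i = z i) ∧
      ∀ i, |z i| ≤ (2 ^ ∑ i, ratBitSize (q i) : ℕ) := by
  classical
  let others (i : ι) : ℕ := ∏ j ∈ Finset.univ.erase i, (q j).den
  refine ⟨∏ i, (q i).den, fun i => (q i).num * others i,
    Finset.prod_pos fun i _ => (q i).den_pos, fun i => ?_, fun i => ?_⟩
  · rw [← Finset.mul_prod_erase _ _ (Finset.mem_univ i), Nat.cast_mul, mul_right_comm,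
      Rat.den_mul_eq_num]
    simp [others]
  · have hothers : others i ≤ ∏ j ∈ Finset.univ.erase i, 2 ^ ratBitSize (q j) :=
      Finset.prod_le_prod' fun j _ => den_le_two_pow_ratBitSize (q j)
    rw [abs_mul, Int.abs_eq_natAbs, Nat.abs_cast, ← Finset.prod_pow_eq_pow_sum,
      ← Finset.mul_prod_erase _ _ (Finset.mem_univ i)]
    exact_mod_cast Nat.mul_le_mul (natAbs_num_le_two_pow_ratBitSize (q i)) hothers

theorem factorial_mul_pow_le_two_pow {r n L : ℕ} (hr : r ≤ L) (hn : n ≤ L) :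
    r.factorial * (n * (2 ^ L) ^ 2) ^ r ≤ 2 ^ (4 * L ^ 2) := by
  have hfact : r.factorial ≤ (2 ^ L) ^ r :=
    r.factorial_le_pow.trans (Nat.pow_le_pow_left (hr.trans Nat.lt_two_pow_self.le) r)
  calc r.factorial * (n * (2 ^ L) ^ 2) ^ r
      ≤ (2 ^ L) ^ r * (2 ^ L * (2 ^ L) ^ 2) ^ r := by
        gcongr
        exact hn.trans Nat.lt_two_pow_self.le
    _ = (2 ^ (4 * L)) ^ r := by rw [← mul_pow]; ring
    _ ≤ (2 ^ (4 * L)) ^ L := Nat.pow_le_pow_right (by positivity) hr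
    _ = 2 ^ (4 * L ^ 2) := by ring

open Matrix

variable {𝕜 : Type*} [Field 𝕜] [LinearOrder 𝕜] [IsStrictOrderedRing 𝕜]

theorem abs_le_two_pow_of_vecMul_ratCast_eq {ι n : Type*} [Fintype ι] [Fintype n]
    {A : Matrix ι n ℚ} (hind : LinearIndependent 𝕜 (A.map ((↑) : ℚ → 𝕜)).row) {w : n → ℚ}
    {t : ι → 𝕜} (ht : t ᵥ* A.map (↑) = fun j => (w j : 𝕜)) {L : ℕ}
    (hL : ∑ i, ∑ j, ratBitSize (A i j) + ∑ j, ratBitSize (w j) ≤ L) (i : ι) :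
    |t i| ≤ 2 ^ (4 * L ^ 2) := by
  obtain ⟨N, z, hN, hz, hzL⟩ := exists_common_denominator (Sum.elim (fun p : ι × n => A p.1 p.2) w)
  let Z : Matrix ι n ℤ := of fun i j => z (.inl (i, j))
  have hz_cast (e) : (z e : 𝕜) = N * (Sum.elim (fun p : ι × n => A p.1 p.2) w e : ℚ) := by
    exact_mod_cast congrArg (Rat.cast : ℚ → 𝕜) (hz e).symm
  have hz_abs (e) : |z e| ≤ (2 ^ L : ℕ) := by
    refine (hzL e).trans ?_
    simp only [Fintype.sum_sum_type, Fintype.sum_prod_type, Sum.elim_inl, Sum.elim_inr]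
    exact_mod_cast Nat.pow_le_pow_right two_pos hL
  have hZ : Z.map ((↑) : ℤ → 𝕜) = (N : 𝕜) • A.map (↑) := by
    ext i j
    simpa [Z] using hz_cast (.inl (i, j))
  have hindZ : LinearIndependent 𝕜 (Z.map ((↑) : ℤ → 𝕜)).row := by
    rw [hZ]
    exact hind.units_smul fun _ => Units.mk0 (N : 𝕜) (by exact_mod_cast hN.ne')
  have htZ : t ᵥ* Z.map (↑) = fun j => (z (.inr j) : 𝕜) := by
    rw [hZ, vecMul_smul, ht]
    ext j
    simp [hz_cast]
  have hn : Fintype.card n ≤ L := (card_le_sum_ratBitSize w).trans (by omega)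
  have hι : Fintype.card ι ≤ L := by simpa using hind.fintype_card_le_finrank.trans (by simpa)
  exact (abs_le_of_vecMul_intCast_eq_of_linearIndependent hindZ (fun _ _ => hz_abs _)
    (fun _ => hz_abs _) htZ i).trans (by exact_mod_cast factorial_mul_pow_le_two_pow hι hn)

theorem exists_bounded_multipliers {m n : ℕ} {A : Matrix (Fin m) (Fin n) ℚ} {w : Fin n → ℚ}
    {β : Fin m → 𝕜} {y : Fin n → 𝕜} (hy : β ≤ A.map (↑) *ᵥ y)
    (hmin : ∀ z, β ≤ A.map (↑) *ᵥ z → (fun j => (w j : 𝕜)) ⬝ᵥ y ≤ (fun j => (w j : 𝕜)) ⬝ᵥ z) :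
    ∃ t : Fin m → 𝕜, (∀ i, 0 ≤ t i ∧ t i ≤ 2 ^ (4 * (matBitSize A + vecBitSize w) ^ 2)) ∧
      (∀ i, t i * (A.map (↑) *ᵥ y) i = t i * β i) ∧ t ᵥ* A.map (↑) = fun j => (w j : 𝕜) := by
  classical
  obtain ⟨s, t, hact, ht, hind, hsum⟩ := exists_linearIndepOn_multipliers
    (a := fun i => dotProductEquiv 𝕜 (Fin n) ((A.map (↑)).row i))
    (c := dotProductEquiv 𝕜 (Fin n) fun j => (w j : 𝕜)) hy hmin
  simp only [← map_smul, ← map_sum, EmbeddingLike.apply_eq_iff_eq] at hsum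
  have hind_row : LinearIndependent 𝕜 ((A.submatrix ((↑) : s → Fin m) id).map ((↑) : ℚ → 𝕜)).row :=
    LinearIndependent.of_comp (dotProductEquiv 𝕜 (Fin n)).toLinearMap hind
  have hsum_row : (fun i : s => t i) ᵥ* (A.submatrix ((↑) : s → Fin m) id).map (↑) =
      fun j => (w j : 𝕜) := by
    rw [← hsum, ← Finset.sum_coe_sort, vecMul_eq_sum]
    rfl
  have hbits : ∑ i : s, ∑ j, ratBitSize (A i j) + ∑ j, ratBitSize (w j) ≤
      matBitSize A + vecBitSize w := by
    have : ∑ i ∈ s, ∑ j, ratBitSize (A i j) ≤ ∑ i, ∑ j, ratBitSize (A i j) :=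
      Finset.sum_le_univ_sum_of_nonneg fun _ => Nat.zero_le _
    rw [Finset.sum_coe_sort s fun i => ∑ j, ratBitSize (A i j), matBitSize, vecBitSize]
    omega
  have hbound (i : Fin m) (hi : i ∈ s) : t i ≤ 2 ^ (4 * (matBitSize A + vecBitSize w) ^ 2) :=
    (le_abs_self _).trans (abs_le_two_pow_of_vecMul_ratCast_eq hind_row hsum_row hbits ⟨i, hi⟩)
  refine ⟨fun i => if i ∈ s then t i else 0, fun i => ?_, fun i => ?_, ?_⟩
  · dsimp only
    split_ifs with hi
    exacts [⟨ht i hi, hbound i hi⟩, ⟨le_rfl, by positivity⟩]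
  · dsimp only
    split_ifs with hi
    exacts [congrArg _ (hact i hi), by simp]
  · simpa [vecMul_eq_sum, ite_smul, row] using hsum

end RationalSystems

section Minimizers

theorem globalMinimizers_congr {α β γ : Type*} [Preorder β] [Preorder γ] {s : Set α} {g : α → β}
    {g' : α → γ} (h : ∀ z ∈ s, ∀ z' ∈ s, g z ≤ g z' ↔ g' z ≤ g' z') :
    globalMinimizers s g = globalMinimizers s g' :=
  Set.ext fun _ => and_congr_right fun hz => forall₂_congr fun z' hz' => h _ hz z' hz'

theorem nonempty_globalMinimizers {α β : Type*} [TopologicalSpace α] [LinearOrder β]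
    [TopologicalSpace β] [ClosedIicTopology β] {s : Set α} {g : α → β} (hs : IsCompact s)
    (hne : s.Nonempty) (hg : ContinuousOn g s) : (globalMinimizers s g).Nonempty :=
  hs.exists_isMinOn hne hg

theorem isCompact_globalMinimizers {α β : Type*} [TopologicalSpace α] [Preorder β]
    [TopologicalSpace β] [ClosedIicTopology β] {s : Set α} {g : α → β} (hs : IsCompact s)
    (hg : Continuous g) : IsCompact (globalMinimizers s g) := by
  have : globalMinimizers s g = s ∩ ⋂ z ∈ s, g ⁻¹' Set.Iic (g z) := by
    ext
    simp [globalMinimizers]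
  rw [this]
  exact hs.inter_right (isClosed_biInter fun z _ => isClosed_Iic.preimage hg)

theorem globalMinimizers_prod {α β γ : Type*} [Preorder γ] {X : Set α} {Y : α → Set β}
    {F : α → γ} {G : α × β → γ}
    (hne : ∀ x ∈ X, (globalMinimizers (Y x) fun y => G (x, y)).Nonempty)
    (hF : ∀ x ∈ X, ∀ y ∈ globalMinimizers (Y x) (fun y => G (x, y)), G (x, y) = F x) :
    globalMinimizers {q | q.1 ∈ X ∧ q.2 ∈ Y q.1} G =
      {q | q.1 ∈ globalMinimizers X F ∧ q.2 ∈ globalMinimizers (Y q.1) fun y => G (q.1, y)} := by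
  ext ⟨x, y⟩
  constructor
  · rintro ⟨⟨hx, hy⟩, hmin⟩
    have hymin : y ∈ globalMinimizers (Y x) fun y => G (x, y) :=
      ⟨hy, fun y' hy' => hmin (x, y') ⟨hx, hy'⟩⟩
    refine ⟨⟨hx, fun x' hx' => ?_⟩, hymin⟩
    obtain ⟨y', hy'⟩ := hne x' hx'
    rw [← hF x hx y hymin, ← hF x' hx' y' hy']
    exact hmin (x', y') ⟨hx', hy'.1⟩
  · rintro ⟨⟨hx, hxmin⟩, hy⟩
    refine ⟨⟨hx, hy.1⟩, fun ⟨x', y'⟩ ⟨hx', hy'⟩ => ?_⟩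
    obtain ⟨y'', hy''⟩ := hne x' hx'
    calc G (x, y) = F x := hF x hx y hy
      _ ≤ F x' := hxmin x' hx'
      _ = G (x', y'') := (hF x' hx' y'' hy'').symm
      _ ≤ G (x', y') := hy''.2 y' hy'

theorem globalMinimizers_add_mul_eq {α 𝕜 : Type*} [CommRing 𝕜] [LinearOrder 𝕜]
    [IsStrictOrderedRing 𝕜] {s : Set α} {d f : α → 𝕜} {y₀ : α} {μ κ : 𝕜}
    (hy₀ : y₀ ∈ globalMinimizers (globalMinimizers s f) d) (hμκ : μ < κ)
    (hgap : ∀ y ∈ s, d y₀ ≤ d y + μ * (f y - f y₀)) :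
    globalMinimizers s (fun y => d y + κ * f y) = globalMinimizers (globalMinimizers s f) d := by
  obtain ⟨⟨hy₀s, hf⟩, hd⟩ := hy₀
  have hpen (y) (hy : y ∈ s) : (κ - μ) * (f y - f y₀) ≤ d y + κ * f y - (d y₀ + κ * f y₀) := by
    linarith [hgap y hy]
  ext y
  constructor
  · rintro ⟨hy, hmin⟩
    have hfy : f y ≤ f y₀ := by
      have := (hpen y hy).trans (sub_nonpos.2 (hmin y₀ hy₀s))
      exact sub_nonpos.1 (nonpos_of_mul_nonpos_right this (sub_pos.2 hμκ))
    have hfy_eq : f y = f y₀ := hfy.antisymm (hf y hy)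
    have hdy : d y ≤ d y₀ := by simpa [hfy_eq] using hmin y₀ hy₀s
    exact ⟨⟨hy, fun z hz => hfy.trans (hf z hz)⟩, fun z hz => hdy.trans (hd z hz)⟩
  · rintro ⟨⟨hy, hfy⟩, hdy⟩
    refine ⟨hy, fun z hz => ?_⟩
    have hfy_eq : f y = f y₀ := (hfy y₀ hy₀s).antisymm (hf y hy)
    have hdy_le : d y ≤ d y₀ := hdy y₀ ⟨hy₀s, hf⟩
    have := mul_nonneg (sub_nonneg.2 hμκ.le) (sub_nonneg.2 (hf z hz))
    change d y + κ * f y ≤ d z + κ * f z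
    rw [hfy_eq]
    linarith [hpen z hz]

end Minimizers

namespace LinearBilevel

open Matrix

variable {nx ny k m : ℕ} (P : LinearBilevel nx ny k m)

theorem continuous_dVal : Continuous P.dVal := by unfold dVal; fun_prop

theorem continuous_fVal : Continuous P.fVal := by unfold fVal; fun_prop

theorem argmin_dVal_nonempty {x : Fin nx → ℝ} (hne : (P.lowerFeasible x).Nonempty)
    (hc : IsCompact (P.lowerFeasible x)) : (globalMinimizers (P.S x) P.dVal).Nonempty :=
  nonempty_globalMinimizers (isCompact_globalMinimizers hc P.continuous_fVal)
    (nonempty_globalMinimizers hc hne P.continuous_fVal.continuousOn) P.continuous_dVal.continuousOn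

/-- The constraint matrix of the linear program `min {dᵀ y | -fᵀ y ≥ -φ(x), D y ≥ b - C x}`
which, for `φ(x)` the follower's optimal value, minimizes `dᵀ y` over `S(x)`. -/
def optimalFaceMatrix : Matrix (Fin (m + 1)) (Fin ny) ℚ :=
  of (Fin.cons (-P.f) P.D)

@[simp]
theorem optimalFaceMatrix_zero : P.optimalFaceMatrix 0 = -P.f := rfl

@[simp]
theorem optimalFaceMatrix_succ (i : Fin m) : P.optimalFaceMatrix i.succ = P.D i := rfl

theorem bitSize_optimalFaceMatrix_le :
    matBitSize P.optimalFaceMatrix + vecBitSize P.d ≤ P.bitSize := by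
  have : matBitSize P.optimalFaceMatrix = matBitSize P.D + vecBitSize P.f := by
    simp only [matBitSize, vecBitSize, Fin.sum_univ_succ, optimalFaceMatrix_zero,
      optimalFaceMatrix_succ, Pi.neg_apply, ratBitSize_neg]
    ring
  rw [this, bitSize]
  omega

theorem optimalFaceMatrix_mulVec (y : Fin ny → ℝ) :
    P.optimalFaceMatrix.map (↑) *ᵥ y =
      Fin.cons (-P.fVal y) fun i => ∑ j, (P.D i j : ℝ) * y j := by
  ext i
  refine Fin.cases ?_ (fun i => ?_) i
  · simp [mulVec, dotProduct, fVal]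
  · simp [mulVec, dotProduct]

theorem exists_gap_multiplier {x : Fin nx → ℝ} {y₀ : Fin ny → ℝ}
    (hy₀ : y₀ ∈ globalMinimizers (P.S x) P.dVal) :
    ∃ μ : ℝ, μ ≤ 2 ^ (4 * P.bitSize ^ 2) ∧
      ∀ y ∈ P.lowerFeasible x, P.dVal y₀ ≤ P.dVal y + μ * (P.fVal y - P.fVal y₀) := by
  obtain ⟨⟨hfeas, hfmin⟩, hdmin⟩ := hy₀
  let β : Fin (m + 1) → ℝ :=
    Fin.cons (-P.fVal y₀) fun i => (P.b i : ℝ) - ∑ j, (P.C i j : ℝ) * x j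
  have hβ (y : Fin ny → ℝ) : β ≤ P.optimalFaceMatrix.map (↑) *ᵥ y ↔
      P.fVal y ≤ P.fVal y₀ ∧ y ∈ P.lowerFeasible x := by
    simp only [optimalFaceMatrix_mulVec, β, Pi.le_def, Fin.forall_fin_succ, Fin.cons_zero,
      Fin.cons_succ, neg_le_neg_iff, sub_le_iff_le_add', lowerFeasible, Set.mem_ofPred_eq]
  obtain ⟨t, ht, hslack, hsum⟩ := exists_bounded_multipliers ((hβ y₀).2 ⟨le_rfl, hfeas⟩)
    fun z hz => hdmin z ⟨((hβ z).1 hz).2, fun u hu => ((hβ z).1 hz).1.trans (hfmin u hu)⟩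
  refine ⟨t 0, (ht 0).2.trans ?_, fun y hy => ?_⟩
  · have := P.bitSize_optimalFaceMatrix_le
    gcongr
    exact one_le_two
  have hd (y : Fin ny → ℝ) : P.dVal y =
      -(t 0 * P.fVal y) + ∑ i, t (Fin.succ i) * ∑ j, (P.D i j : ℝ) * y j := by
    calc P.dVal y = (t ᵥ* P.optimalFaceMatrix.map (↑)) ⬝ᵥ y := by rw [hsum]; rfl
      _ = t ⬝ᵥ Fin.cons (-P.fVal y) fun i => ∑ j, (P.D i j : ℝ) * y j := by
        rw [← dotProduct_mulVec, optimalFaceMatrix_mulVec]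
      _ = _ := by simp [dotProduct, Fin.sum_univ_succ]
  have hD : ∑ i, t (Fin.succ i) * ∑ j, (P.D i j : ℝ) * y₀ j ≤
      ∑ i, t (Fin.succ i) * ∑ j, (P.D i j : ℝ) * y j := by
    refine Finset.sum_le_sum fun i _ => ?_
    have hact := hslack i.succ
    simp only [optimalFaceMatrix_mulVec, β, Fin.cons_succ] at hact
    rw [hact]
    exact mul_le_mul_of_nonneg_left (sub_le_iff_le_add'.2 (hy i)) (ht i.succ).1
  rw [hd, hd]
  linarith

theorem globalMinimizers_penalized_eq {κ : ℝ} (hκ : 2 ^ (4 * P.bitSize ^ 2) < κ)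
    {x : Fin nx → ℝ} (hne : (globalMinimizers (P.S x) P.dVal).Nonempty) :
    globalMinimizers (P.lowerFeasible x) (fun y => P.dVal y + κ * P.fVal y) =
      globalMinimizers (P.S x) P.dVal := by
  obtain ⟨y₀, hy₀⟩ := hne
  obtain ⟨μ, hμ, hgap⟩ := P.exists_gap_multiplier hy₀
  exact globalMinimizers_add_mul_eq hy₀ (hμ.trans_lt hκ) hgap

theorem optimisticObjective_eq {x : Fin nx → ℝ} {y : Fin ny → ℝ}
    (hy : y ∈ globalMinimizers (P.S x) P.dVal) :
    P.optimisticObjective x = ((P.cVal x + P.dVal y : ℝ) : EReal) := by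
  rw [optimisticObjective, EReal.coe_add]
  congr 1
  exact le_antisymm (iInf₂_le y hy.1)
    (le_iInf₂ fun z hz => EReal.coe_le_coe_iff.2 (hy.2 z hz))

theorem pessimisticObjective_eq (κ : ℝ) {x : Fin nx → ℝ} {y y₀ : Fin ny → ℝ}
    (hy : y ∈ P.lowerFeasible x) (hy₀ : y₀ ∈ P.S x) :
    P.pessimisticObjective κ (x, y) =
      ((P.cVal x + P.dVal y + κ * (P.fVal y - P.fVal y₀) : ℝ) : EReal) := by
  rw [pessimisticObjective, EReal.coe_add (P.cVal x + P.dVal y)]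
  congr 1
  have hmem : (y₀, P.fVal y - P.fVal y₀) ∈ P.STilde x y :=
    ⟨⟨hy₀.1, rfl, sub_nonneg.2 (hy₀.2 y hy)⟩, fun q hq => hy₀.2 q.1 hq.1⟩
  refine le_antisymm (iSup₂_le fun q hq => ?_) (le_iSup₂_of_le _ hmem le_rfl)
  have hfVal : P.fVal q.1 = P.fVal y₀ := (hq.2 _ hmem.1).antisymm (hy₀.2 _ hq.1.1)
  rw [← hq.1.2.1, hfVal]

theorem globalMinimizers_pessimisticObjective_eq {κ : ℝ} (hκ : 2 ^ (4 * P.bitSize ^ 2) < κ)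
    {x : Fin nx → ℝ} (hne : (globalMinimizers (P.S x) P.dVal).Nonempty) :
    globalMinimizers (P.lowerFeasible x) (fun y => P.pessimisticObjective κ (x, y)) =
      globalMinimizers (P.S x) P.dVal := by
  rw [← P.globalMinimizers_penalized_eq hκ hne]
  obtain ⟨y₀, hy₀⟩ := hne
  refine globalMinimizers_congr fun y hy z hz => ?_
  rw [P.pessimisticObjective_eq κ hy hy₀.1, P.pessimisticObjective_eq κ hz hy₀.1,
    EReal.coe_le_coe_iff]
  constructor <;> intro h <;> linarith

theorem pessimisticSolutions_eq {κ : ℝ} (hκ : 2 ^ (4 * P.bitSize ^ 2) < κ)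
    (hne : ∀ x ∈ P.X, (globalMinimizers (P.S x) P.dVal).Nonempty) :
    P.pessimisticSolutions κ =
      {q | q.1 ∈ P.optimisticSolutions ∧ q.2 ∈ globalMinimizers (P.S q.1) P.dVal} := by
  have hfiber (x) (hx : x ∈ P.X) := P.globalMinimizers_pessimisticObjective_eq hκ (hne x hx)
  have hvalue (x y) (hy : y ∈ globalMinimizers (P.S x) P.dVal) :
      P.pessimisticObjective κ (x, y) = P.optimisticObjective x := by
    rw [P.pessimisticObjective_eq κ hy.1.1 hy.1, P.optimisticObjective_eq hy, sub_self, mul_zero,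
      add_zero]
  refine (globalMinimizers_prod (F := P.optimisticObjective) (fun x hx => ?_)
    fun x hx y hy => hvalue x y (hfiber x hx ▸ hy)).trans ?_
  · exact (hfiber x hx).symm ▸ hne x hx
  · exact Set.ext fun q => and_congr_right fun hq => by rw [hfiber q.1 hq.1]

end LinearBilevel

theorem mainTheorem2_general :
    ∃ p : Polynomial ℕ, ∀ (nx ny k m : ℕ) (P : LinearBilevel nx ny k m),
      (∀ x ∈ P.X, (globalMinimizers (P.S x) P.dVal).Nonempty) →
        ∃ κ : ℚ, 0 < κ ∧ ratBitSize κ ≤ p.eval P.bitSize ∧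
          P.optimisticSolutions = Prod.fst '' P.pessimisticSolutions (κ : ℝ) ∧
          P.pessimisticSolutions (κ : ℝ) =
            {q | q.1 ∈ P.optimisticSolutions ∧
              q.2 ∈ globalMinimizers (P.S q.1) P.dVal} := by
  refine ⟨4 * Polynomial.X ^ 2 + 4, fun nx ny k m P hne => ?_⟩
  have hsol := P.pessimisticSolutions_eq (κ := ((2 ^ (4 * P.bitSize ^ 2 + 1) : ℚ) : ℝ))
    (by push_cast; exact pow_lt_pow_right₀ one_lt_two (Nat.lt_succ_self _)) hne
  refine ⟨2 ^ (4 * P.bitSize ^ 2 + 1), by positivity, ?_, ?_, hsol⟩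
  · rw [ratBitSize_two_pow]
    simp
  · rw [hsol]
    refine Set.Subset.antisymm (fun x hx => ?_) (Set.image_subset_iff.2 fun q hq => hq.1)
    obtain ⟨y, hy⟩ := hne x hx.1
    exact ⟨(x, y), ⟨hx, hy⟩, rfl⟩

theorem mainTheorem2 :
    ∃ p : Polynomial ℕ, ∀ (nx ny k m : ℕ) (P : LinearBilevel nx ny k m),
      P.StandingAssumptions →
        ∃ κ : ℚ, 0 < κ ∧ ratBitSize κ ≤ p.eval P.bitSize ∧
          P.optimisticSolutions = Prod.fst '' P.pessimisticSolutions (κ : ℝ) ∧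
          P.pessimisticSolutions (κ : ℝ) =
            {q | q.1 ∈ P.optimisticSolutions ∧
              q.2 ∈ globalMinimizers (P.S q.1) P.dVal} :=
  mainTheorem2_general.imp fun _ hp nx ny k m P hP => hp nx ny k m P fun x hx =>
    P.argmin_dVal_nonempty (hP.lower_nonempty x hx) (hP.lower_compact x hx)
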